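/- Let $\mathcal I$ be a finite set of cells, let $J\ge 1$, let $S_1,\dots,S_J\subseteq\mathcal I$ be non-empty, and let $\mathbf A=(a_{ji})$ be the $J\times|\mathcal I|$ matrix whose rows $A_1,\dots,A_J$ are the indicators of $S_1,\dots,S_J$. A positive vector $\boldsymbol\delta=(\delta(i))_{i\in\mathcal I}$ is in the relational model generated by $\mathbf A$ if $\log\boldsymbol\delta=\mathbf A'\boldsymbol\beta$ for some $\boldsymbol\beta\in\mathbb R^J$; in the model for probabilities, $\boldsymbol\delta=\boldsymbol p$ is required in addition to satisfy $\sum_i p(i)=1$, and in the model for intensities, $\boldsymbol\delta=\boldsymbol\lambda$ is any such positive vector. The overall effect is present if the vector $\boldsymbol 1$ of ones is in the row space of $\mathbf A$. A maximum likelihood estimate (MLE) under the model is a point of the model that maximizes, over the model, the probability of the observation $\boldsymbol y\in\mathbb Z_{\ge0}^{\mathcal I}$. For $\boldsymbol q\in\mathbb R^{\mathcal I}$ and $\gamma>0$, IPF$(\gamma)$ generates the sequence $\boldsymbol\delta_\gamma^{(d)}$, $d\ge0$, with $\delta^{(0)}_\gamma(i)=1$ and $$\delta_{\gamma}^{(d+1)}(i)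 = \delta_{\gamma}^{(d)}(i) \left(\gamma\, \frac{A_{j}\boldsymbol{q}}{A_{j}\boldsymbol{\delta}_{\gamma}^{(d)}}\right)^{a_{ji}},\qquad i\in\mathcal I,$$ where $j\in\{1,\dots,J\}$ and $j\equiv d+1 \bmod J$. 1. Let $\boldsymbol y$ be a realization of a multinomial random variable with parameters $N\ge1$ and $\boldsymbol p$, and let $\boldsymbol q=\boldsymbol y/N$. (a) Suppose that the overall effect is present. An MLE of $\boldsymbol p$ under the model for probabilities exists if and only if there is a positive probability vector $\boldsymbol r$ with $\mathbf A\boldsymbol r=\mathbf A\boldsymbol q$. If $\hat{\boldsymbol p}$ is an MLE, then the sequence obtained from IPF$(1)$ converges to $\hat{\boldsymbol p}$ (in particular, the MLE is unique). (b) Suppose that the overall effect is not present. Call $\gamma^*>0$ an adjustment factor if some $\boldsymbol p$ in the model for probabilities satisfies $\mathbf A\boldsymbol p=\gamma^*\mathbf A\boldsymbol q$. An MLE of $\boldsymbol p$ under the model exists if and only if an adjustment factor exists. The adjustment factor $\gamma^*$ is then unique, and the sequence obtained from IPF$(\gamma^*)$ converges to the MLE $\hat{\boldsymbol p}$. 2.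 Let $\boldsymbol y$ be a realization of a vector of independent Poisson random variables with parameter $\boldsymbol\lambda$, and let $\boldsymbol q=\boldsymbol y$. Whether or not the overall effect is present, an MLE of $\boldsymbol\lambda$ under the model for intensities exists if and only if there is a positive vector $\boldsymbol r$ with $\mathbf A\boldsymbol r=\mathbf A\boldsymbol q$; and if $\hat{\boldsymbol\lambda}$ is an MLE, then the sequence obtained from IPF$(1)$ converges to $\hat{\boldsymbol\lambda}$. -/

import Mathlib

open Filter Topology

namespace RelationalModel

noncomputable section

/-- The model matrix of the class `S 0, …, S (J-1)` of subsets of the table `ι`: its rows are the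
indicators of the generating subsets. -/
def modelMatrix {ι : Type*} [DecidableEq ι] {J : ℕ} (S : Fin J → Finset ι) :
    Matrix (Fin J) ι ℝ :=
  Matrix.of fun j i => if i ∈ S j then 1 else 0

/-- The overall effect is present: the vector of ones lies in the row space of the model matrix. -/
def HasOverallEffect {ι : Type*} [DecidableEq ι] {J : ℕ} (S : Fin J → Finset ι) : Prop :=
  (1 : ι → ℝ) ∈ Submodule.span ℝ (Set.range (modelMatrix S).row)

/-- Parameters of the positive distributions described by intensities. -/
def positiveIntensities (ι : Type*) : Set (ι → ℝ) :=
  {l | ∀ i, 0 < l i}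

/-- Parameters of the positive distributions described by probabilities. -/
def positiveProbabilities (ι : Type*) [Fintype ι] : Set (ι → ℝ) :=
  {p | (∀ i, 0 < p i) ∧ ∑ i, p i = 1}

/-- The relational model generated by `S`, within the set `P` of positive parameter vectors
(probabilities or intensities): `log δ = A' β` for some `β`. -/
def model {ι : Type*} [DecidableEq ι] {J : ℕ} (P : Set (ι → ℝ))
    (S : Fin J → Finset ι) : Set (ι → ℝ) :=
  {δ | δ ∈ P ∧ ∃ β : Fin J → ℝ, (fun i => Real.log (δ i)) = (modelMatrix S).transpose.mulVec β}

/-- The linear family `{δ ∈ P : A δ = γ A q}`. -/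
def linearFamily {ι : Type*} [Fintype ι] [DecidableEq ι] {J : ℕ} (P : Set (ι → ℝ))
    (S : Fin J → Finset ι) (q : ι → ℝ) (γ : ℝ) : Set (ι → ℝ) :=
  {δ | δ ∈ P ∧ (modelMatrix S).mulVec δ = γ • (modelMatrix S).mulVec q}

/-- The probability of the table `y` under the multinomial distribution with parameters
`N` and `p`. -/
def multinomialProb {ι : Type*} [Fintype ι] (N : ℕ) (p : ι → ℝ) (y : ι → ℕ) : ℝ :=
  if ∑ i, y i = N then (Nat.multinomial Finset.univ y : ℝ) * ∏ i, p i ^ y i else 0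

/-- The probability of the table `y` when the cell counts are independent Poisson variables with
intensities `l i`. -/
def poissonProb {ι : Type*} [Fintype ι] (l : ι → ℝ) (y : ι → ℕ) : ℝ :=
  ∏ i, Real.exp (-l i) * l i ^ y i / ((y i).factorial : ℝ)

/-- `δ` is a maximum likelihood estimate under the model `M`: it belongs to `M` and maximizes the
likelihood over `M`. -/
def IsMLE {ι : Type*} (M : Set (ι → ℝ)) (likelihood : (ι → ℝ) → ℝ) (δ : ι → ℝ) : Prop :=
  δ ∈ M ∧ ∀ δ' ∈ M, likelihood δ' ≤ likelihood δ

/-- `p` is an MLE of the cell probabilities, given the multinomial observation `y` of total `N`. -/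
def IsMultinomialMLE {ι : Type*} [Fintype ι] [DecidableEq ι] {J : ℕ} (S : Fin J → Finset ι)
    (N : ℕ) (y : ι → ℕ) (p : ι → ℝ) : Prop :=
  IsMLE (model (positiveProbabilities ι) S) (fun p' => multinomialProb N p' y) p

/-- `l` is an MLE of the cell intensities, given the Poisson observation `y`. -/
def IsPoissonMLE {ι : Type*} [Fintype ι] [DecidableEq ι] {J : ℕ} (S : Fin J → Finset ι)
    (y : ι → ℕ) (l : ι → ℝ) : Prop :=
  IsMLE (model (positiveIntensities ι) S) (fun l' => poissonProb l' y) l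

/-- The observed relative frequencies `y / (1 y)`. -/
def relFreq {ι : Type*} [Fintype ι] (y : ι → ℕ) : ι → ℝ :=
  fun i => (y i : ℝ) / ∑ k, (y k : ℝ)

/-- The observed counts as a real vector. -/
def counts {ι : Type*} (y : ι → ℕ) : ι → ℝ :=
  fun i => (y i : ℝ)

/-- `γ` is an adjustment factor for the model for probabilities: `γ > 0`, and the multiplicative
family and the linear family `A p = γ A q` share a probability distribution (a point of
total `1`). -/
def IsAdjustmentFactor {ι : Type*} [Fintype ι] [DecidableEq ι] {J : ℕ} (S : Fin J → Finset ι)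
    (q : ι → ℝ) (γ : ℝ) : Prop :=
  0 < γ ∧ (model (positiveProbabilities ι) S ∩
    linearFamily (positiveProbabilities ι) S q γ).Nonempty

/-- One step of `IPF(γ)`, adjusting the `j`-th subset sum. -/
def ipfStep {ι : Type*} [Fintype ι] [DecidableEq ι] {J : ℕ} (S : Fin J → Finset ι)
    (q : ι → ℝ) (γ : ℝ) (j : Fin J) (δ : ι → ℝ) : ι → ℝ :=
  fun i => δ i *
    (γ * (modelMatrix S).mulVec q j / (modelMatrix S).mulVec δ j) ^ (modelMatrix S j i)

/-- The sequence of cell parameters generated by `IPF(γ)`: it starts from the vector of ones and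
runs cyclically through the subsets (`Fin.ofNat J d` is `d` modulo `J`, subsets being numbered
from `0`). -/
def ipf {ι : Type*} [Fintype ι] [DecidableEq ι] {J : ℕ} [NeZero J] (S : Fin J → Finset ι)
    (q : ι → ℝ) (γ : ℝ) : ℕ → ι → ℝ
  | 0 => 1
  | d + 1 => ipfStep S q γ (Fin.ofNat J d) (ipf S q γ d)

end

end RelationalModel

open RelationalModel

/-! Everything rests on `logFit r δ = ∑ (r log δ - δ)`, which is minus the Kullback-Leibler
divergence of `δ` from `r`, up to a term in `r`. For positive `r` it has the unique maximizer `δ =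
r`, and its superlevel sets lie in compact sets of positive vectors. If `log δ` is in the row space,
`logFit r δ` depends on `r` only through `A r` (`logFit_congr`), so a point of the model is
determined by its subset sums.

Let `r` be any positive vector with `A r = γ A q`. Each IPF step raises `logFit r` by a
one-dimensional divergence between the current and the target subset sum (`logFit_ipfStep`). The
iterates therefore stay in a compact set and the gains tend to zero. A limit along complete cycles
has the right subset sums; taking it as the new `r` forces the whole sequence to converge to it
(`tendsto_ipf_of_subseq`).

The MLEs are the model points solving the likelihood equations: `A l = A y` for Poisson, and `A p =
γ A q` with a Lagrange multiplier `γ > 0` for multinomial sampling. The overall effect makes totals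
a function of subset sums and forces `γ = 1`; otherwise `γ` is the adjustment factor. -/

namespace RelationalModel

/-! ### The divergence functional and the likelihoods. -/

section Fit

variable {ι : Type*} [Fintype ι]

/-- The Poisson log-likelihood, up to an additive constant, of the intensities `δ` given `r`. -/
noncomputable def logFit (r δ : ι → ℝ) : ℝ :=
  ∑ i, (r i * Real.log (δ i) - δ i)

theorem mul_log_sub_le {r t : ℝ} (hr : 0 < r) (ht : 0 < t) :
    r * Real.log t - t ≤ r * Real.log r - r := by
  have h := Real.log_le_sub_one_of_pos (div_pos ht hr)
  rw [Real.log_div ht.ne' hr.ne'] at h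
  have h2 := mul_le_mul_of_nonneg_left h hr.le
  have h3 : r * (t / r - 1) = t - r := by field_simp
  linarith

theorem mul_log_sub_lt {r t : ℝ} (hr : 0 < r) (ht : 0 < t) (hne : t ≠ r) :
    r * Real.log t - t < r * Real.log r - r := by
  have h := Real.log_lt_sub_one_of_pos (div_pos ht hr) (by rwa [Ne, div_eq_one_iff_eq hr.ne'])
  rw [Real.log_div ht.ne' hr.ne'] at h
  have h2 := mul_lt_mul_of_pos_left h hr
  have h3 : r * (t / r - 1) = t - r := by field_simp
  linarith

theorem exists_bounds_of_le_mul_log_sub {r : ℝ} (hr : 0 < r) (C : ℝ) :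
    ∃ ε M : ℝ, 0 < ε ∧ ∀ t, 0 < t → C ≤ r * Real.log t - t → t ∈ Set.Icc ε M := by
  -- The lower bound drops `-t`. The upper one halves the maximum of `2r log t - t`, attained at
  -- `2r`, and keeps the other `t / 2`.
  refine ⟨Real.exp (C / r), 2 * (r * Real.log (2 * r) - r - C), Real.exp_pos _,
    fun t ht h => ⟨?_, ?_⟩⟩
  · rw [← Real.le_log_iff_exp_le ht, div_le_iff₀ hr]
    linarith
  · have h1 := mul_log_sub_le (mul_pos two_pos hr) ht
    linarith

theorem logFit_le {r δ : ι → ℝ} (hr : ∀ i, 0 < r i) (hδ : ∀ i, 0 < δ i) :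
    logFit r δ ≤ logFit r r :=
  Finset.sum_le_sum fun i _ => mul_log_sub_le (hr i) (hδ i)

theorem eq_of_logFit_eq {r δ : ι → ℝ} (hr : ∀ i, 0 < r i) (hδ : ∀ i, 0 < δ i)
    (h : logFit r δ = logFit r r) : δ = r := by
  have h' := (Finset.sum_eq_sum_iff_of_le
    fun i _ => mul_log_sub_le (hr i) (hδ i)).1 h
  funext i
  by_contra hne
  exact (mul_log_sub_lt (hr i) (hδ i) hne).ne (h' i (Finset.mem_univ i))

theorem continuousAt_logFit (r : ι → ℝ) {δ : ι → ℝ} (hδ : ∀ i, 0 < δ i) :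
    ContinuousAt (logFit r) δ := by
  unfold logFit
  refine tendsto_finsetSum _ fun i _ => ?_
  exact ((((continuous_apply i).continuousAt.tendsto).log (hδ i).ne').const_mul _).sub
    (continuous_apply i).continuousAt.tendsto

/-- Superlevel sets of `logFit r` lie in a compact box of positive vectors. -/
theorem exists_compact_of_le_logFit {r : ι → ℝ} (hr : ∀ i, 0 < r i) (C : ℝ) :
    ∃ K : Set (ι → ℝ), IsCompact K ∧ (∀ δ ∈ K, ∀ i, 0 < δ i) ∧
      ∀ δ, (∀ i, 0 < δ i) → C ≤ logFit r δ → δ ∈ K := by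
  classical
  -- With every other summand at its maximum, the bound on the sum becomes a bound on the summand at
  -- `i`.
  choose ε M hε hM using fun i => exists_bounds_of_le_mul_log_sub (hr i)
    (C - ∑ k ∈ Finset.univ.erase i, (r k * Real.log (r k) - r k))
  refine ⟨Set.univ.pi fun i => Set.Icc (ε i) (M i), isCompact_univ_pi fun i => isCompact_Icc,
    fun δ hδ i => (hε i).trans_le (hδ i trivial).1, fun δ hδ hC i _ => hM i _ (hδ i) ?_⟩
  have h1 : ∑ k ∈ Finset.univ.erase i, (r k * Real.log (δ k) - δ k) ≤
      ∑ k ∈ Finset.univ.erase i, (r k * Real.log (r k) - r k) :=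
    Finset.sum_le_sum fun k _ => mul_log_sub_le (hr k) (hδ k)
  have h2 := Finset.add_sum_erase Finset.univ (fun k => r k * Real.log (δ k) - δ k)
    (Finset.mem_univ i)
  unfold logFit at hC
  linarith

theorem positiveProbabilities_subset : positiveProbabilities ι ⊆ positiveIntensities ι :=
  fun _ h => h.1

theorem poissonProb_eq {l : ι → ℝ} (hl : ∀ i, 0 < l i) (y : ι → ℕ) :
    poissonProb l y = Real.exp (logFit (counts y) l) / ∏ i, ((y i).factorial : ℝ) := by
  rw [poissonProb, Finset.prod_div_distrib, logFit, Real.exp_sum]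
  congr 1
  refine Finset.prod_congr rfl fun i _ => ?_
  rw [counts, sub_eq_neg_add, Real.exp_add, ← Real.log_pow, Real.exp_log (pow_pos (hl i) _)]

theorem poissonProb_le_iff {l l' : ι → ℝ} (hl : ∀ i, 0 < l i) (hl' : ∀ i, 0 < l' i)
    (y : ι → ℕ) :
    poissonProb l' y ≤ poissonProb l y ↔ logFit (counts y) l' ≤ logFit (counts y) l := by
  rw [poissonProb_eq hl, poissonProb_eq hl', div_le_div_iff_of_pos_right, Real.exp_le_exp]
  exact Finset.prod_pos fun i _ => by exact_mod_cast Nat.factorial_pos _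

theorem multinomialProb_eq {N : ℕ} {y : ι → ℕ} (hy : ∑ i, y i = N) {p : ι → ℝ}
    (hp : ∀ i, 0 < p i) : multinomialProb N p y =
      (Nat.multinomial Finset.univ y : ℝ) * Real.exp (∑ i, y i * Real.log (p i)) := by
  rw [multinomialProb, if_pos hy, Real.exp_sum]
  congr 1
  refine Finset.prod_congr rfl fun i _ => ?_
  rw [← Real.log_pow, Real.exp_log (pow_pos (hp i) _)]

theorem multinomialProb_le_iff {N : ℕ} {y : ι → ℕ} (hy : ∑ i, y i = N) {p p' : ι → ℝ}
    (hp : ∀ i, 0 < p i) (hp' : ∀ i, 0 < p' i) :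
    multinomialProb N p' y ≤ multinomialProb N p y ↔
      ∑ i, y i * Real.log (p' i) ≤ ∑ i, y i * Real.log (p i) := by
  rw [multinomialProb_eq hy hp, multinomialProb_eq hy hp', mul_le_mul_iff_right₀,
    Real.exp_le_exp]
  exact_mod_cast Nat.multinomial_pos _ _

theorem sum_relFreq {N : ℕ} {y : ι → ℕ} (hN : 0 < N) (hy : ∑ i, y i = N) :
    ∑ i, relFreq y i = 1 := by
  have : (∑ i, (y i : ℝ)) ≠ 0 := by rw [← Nat.cast_sum, hy]; positivity
  simp only [relFreq]
  rw [← Finset.sum_div, div_self this]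

theorem sum_counts_eq {N : ℕ} {y : ι → ℕ} (hN : 0 < N) (hy : ∑ i, y i = N) (x : ι → ℝ) :
    ∑ i, y i * x i = N * ∑ i, relFreq y i * x i := by
  have hN' : (N : ℝ) ≠ 0 := by positivity
  rw [Finset.mul_sum]
  refine Finset.sum_congr rfl fun i _ => ?_
  rw [relFreq, ← Nat.cast_sum, hy]
  field_simp

end Fit

/-! ### The row space and the model. -/

section LogSpace

variable {ι : Type*} [DecidableEq ι] {J : ℕ}

/-- Logarithms of the vectors in the model: the row space of the model matrix. -/
def logSpace (S : Fin J → Finset ι) : Submodule ℝ (ι → ℝ) :=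
  LinearMap.range (modelMatrix S).transpose.mulVecLin

theorem mem_model_iff {S : Fin J → Finset ι} {P : Set (ι → ℝ)} {δ : ι → ℝ} :
    δ ∈ model P S ↔ δ ∈ P ∧ (fun i => Real.log (δ i)) ∈ logSpace S := by
  simp only [model, logSpace, Set.mem_ofPred_eq, LinearMap.mem_range, Matrix.mulVecLin_apply,
    eq_comm]

theorem hasOverallEffect_iff (S : Fin J → Finset ι) :
    HasOverallEffect S ↔ (1 : ι → ℝ) ∈ logSpace S := by
  rw [HasOverallEffect, logSpace, Matrix.range_mulVecLin]
  rfl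

theorem row_mem_logSpace (S : Fin J → Finset ι) (j : Fin J) :
    (modelMatrix S) j ∈ logSpace S := by
  rw [logSpace, Matrix.range_mulVecLin]
  exact Submodule.subset_span ⟨j, rfl⟩

theorem modelMatrix_eq_zero_or_one (S : Fin J → Finset ι) (j : Fin J) (i : ι) :
    modelMatrix S j i = 0 ∨ modelMatrix S j i = 1 := by
  by_cases h : i ∈ S j <;> simp [modelMatrix, h]

theorem eq_exp_of_mem_model {S : Fin J → Finset ι} {P : Set (ι → ℝ)} (hP : P ⊆ positiveIntensities ι) {δ : ι → ℝ}
    (hδ : δ ∈ model P S) :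
    ∃ β, δ = fun i => Real.exp ((modelMatrix S).transpose.mulVec β i) := by
  obtain ⟨hpos, β, hβ⟩ := hδ
  refine ⟨β, funext fun i => ?_⟩
  rw [← congrFun hβ i, Real.exp_log (hP hpos i)]

/-- These curves through `l` are the variations that yield the Poisson likelihood equations. -/
theorem add_smul_row_mem_model {S : Fin J → Finset ι} {l : ι → ℝ} (hl : l ∈ model (positiveIntensities ι) S) (j : Fin J)
    (t : ℝ) : (fun i => l i * Real.exp (t * modelMatrix S j i)) ∈
      model (positiveIntensities ι) S := by
  rw [mem_model_iff] at hl ⊢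
  refine ⟨fun i => mul_pos (hl.1 i) (Real.exp_pos _), ?_⟩
  convert (logSpace S).add_mem hl.2 ((logSpace S).smul_mem t (row_mem_logSpace S j)) using 1
  funext i
  rw [Real.log_mul (hl.1 i).ne' (Real.exp_pos _).ne', Real.log_exp]
  rfl

end LogSpace

variable {ι : Type*} [Fintype ι] [DecidableEq ι] {J : ℕ}

theorem modelMatrix_mulVec_apply (S : Fin J → Finset ι) (δ : ι → ℝ) (j : Fin J) :
    (modelMatrix S).mulVec δ j = ∑ i ∈ S j, δ i := by
  simp [modelMatrix, Matrix.mulVec, dotProduct]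

theorem modelMatrix_mulVec_pos {S : Fin J → Finset ι} (hS : ∀ j, (S j).Nonempty) {δ : ι → ℝ}
    (hδ : ∀ i, 0 < δ i) (j : Fin J) : 0 < (modelMatrix S).mulVec δ j := by
  rw [modelMatrix_mulVec_apply]
  exact Finset.sum_pos (fun i _ => hδ i) (hS j)

/-- For `x = A'β` the pairing of `r` with `x` is `(A r) ⬝ β`. -/
theorem sum_mul_eq_of_mem_logSpace {S : Fin J → Finset ι} {r q x : ι → ℝ} {c : ℝ}
    (h : (modelMatrix S).mulVec r = c • (modelMatrix S).mulVec q) (hx : x ∈ logSpace S) :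
    ∑ i, r i * x i = c * ∑ i, q i * x i := by
  obtain ⟨β, rfl⟩ := hx
  have key : ∀ z : ι → ℝ, ∑ i, z i * (modelMatrix S).transpose.mulVecLin β i =
      (modelMatrix S).mulVec z ⬝ᵥ β := by
    intro z
    rw [← Matrix.vecMul_transpose, ← Matrix.dotProduct_mulVec]
    rfl
  rw [key, key, h, smul_dotProduct, smul_eq_mul]

theorem logFit_congr {S : Fin J → Finset ι} {r q δ : ι → ℝ}
    (h : (modelMatrix S).mulVec r = (modelMatrix S).mulVec q)
    (hδ : (fun i => Real.log (δ i)) ∈ logSpace S) : logFit r δ = logFit q δ := by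
  have := sum_mul_eq_of_mem_logSpace (r := r) (q := q) (c := 1) (by rwa [one_smul]) hδ
  simp only [logFit, Finset.sum_sub_distrib]
  linarith

/-- `logFit δ'` and `logFit δ` agree at both points, so each point maximizes the functional of the
other. -/
theorem eq_of_mem_model_of_mulVec_eq {S : Fin J → Finset ι} {δ δ' : ι → ℝ}
    (hδ : δ ∈ model (positiveIntensities ι) S)
    (hδ' : δ' ∈ model (positiveIntensities ι) S)
    (h : (modelMatrix S).mulVec δ = (modelMatrix S).mulVec δ') : δ = δ' := by
  rw [mem_model_iff] at hδ hδ'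
  refine eq_of_logFit_eq hδ'.1 hδ.1 (le_antisymm (logFit_le hδ'.1 hδ.1) ?_)
  rw [← logFit_congr h hδ.2, ← logFit_congr h hδ'.2]
  exact logFit_le hδ.1 hδ'.1

theorem log_mem_of_tendsto {S : Fin J → Finset ι} {u : ℕ → ι → ℝ} {δ : ι → ℝ}
    (hδ : ∀ i, 0 < δ i) (hu : Tendsto u atTop (𝓝 δ)) (h : ∀ n, (fun i => Real.log (u n i)) ∈ logSpace S) :
    (fun i => Real.log (δ i)) ∈ logSpace S := by
  refine (Submodule.closed_of_finiteDimensional (logSpace S)).mem_of_tendsto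
    (b := atTop)
    (tendsto_pi_nhds.2 fun i => ?_) (Eventually.of_forall h)
  exact ((tendsto_pi_nhds.1 hu) i).log (hδ i).ne'

/-! ### A single IPF step. -/

section Step

variable {S : Fin J → Finset ι} {q : ι → ℝ} {γ : ℝ} {j : Fin J} {δ : ι → ℝ}

theorem ipfStep_pos (hq : 0 < γ * (modelMatrix S).mulVec q j)
    (ha : 0 < (modelMatrix S).mulVec δ j) (hδ : ∀ i, 0 < δ i) (i : ι) :
    0 < ipfStep S q γ j δ i :=
  mul_pos (hδ i) (Real.rpow_pos_of_pos (div_pos hq ha) _)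

theorem log_ipfStep (hq : 0 < γ * (modelMatrix S).mulVec q j)
    (ha : 0 < (modelMatrix S).mulVec δ j) (hδ : ∀ i, 0 < δ i) (i : ι) :
    Real.log (ipfStep S q γ j δ i) = Real.log (δ i) +
      modelMatrix S j i *
        Real.log (γ * (modelMatrix S).mulVec q j / (modelMatrix S).mulVec δ j) := by
  have hc := div_pos hq ha
  rw [ipfStep, Real.log_mul (hδ i).ne' (Real.rpow_pos_of_pos hc _).ne', Real.log_rpow hc]

/-- The exponent is 0 or 1, so the real power is affine in its base; this form gives continuity and
sums. -/
theorem ipfStep_eq (i : ι) : ipfStep S q γ j δ i = δ i + modelMatrix S j i * δ i *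
    (γ * (modelMatrix S).mulVec q j / (modelMatrix S).mulVec δ j - 1) := by
  rw [ipfStep]
  rcases modelMatrix_eq_zero_or_one S j i with h | h <;> rw [h]
  · simp
  · rw [Real.rpow_one]; ring

theorem ipfStep_eq_self (ha : 0 < (modelMatrix S).mulVec δ j)
    (h : (modelMatrix S).mulVec δ j = γ * (modelMatrix S).mulVec q j) :
    ipfStep S q γ j δ = δ := by
  funext i
  rw [ipfStep_eq, ← h, div_self ha.ne']
  ring

theorem continuous_modelMatrix_mulVec (S : Fin J → Finset ι) (j : Fin J) :
    Continuous fun δ : ι → ℝ => (modelMatrix S).mulVec δ j := by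
  simp only [modelMatrix_mulVec_apply]
  fun_prop

theorem continuousAt_ipfStep (ha : 0 < (modelMatrix S).mulVec δ j) :
    ContinuousAt (ipfStep S q γ j) δ := by
  refine continuousAt_pi.2 fun i => ?_
  have h1 := (continuous_modelMatrix_mulVec S j).continuousAt (x := δ)
  simp only [ipfStep_eq]
  have h2 := (continuous_apply i).continuousAt (x := δ)
  exact h2.add ((continuousAt_const.mul h2).mul
    ((continuousAt_const.div h1 ha.ne').sub continuousAt_const))

theorem log_ipfStep_mem (hq : 0 < γ * (modelMatrix S).mulVec q j)
    (ha : 0 < (modelMatrix S).mulVec δ j) (hδ : ∀ i, 0 < δ i)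
    (h : (fun i => Real.log (δ i)) ∈ logSpace S) :
    (fun i => Real.log (ipfStep S q γ j δ i)) ∈ logSpace S := by
  convert (logSpace S).add_mem h ((logSpace S).smul_mem
    (Real.log (γ * (modelMatrix S).mulVec q j / (modelMatrix S).mulVec δ j))
    (row_mem_logSpace S j)) using 1
  funext i
  rw [log_ipfStep hq ha hδ, Pi.add_apply, Pi.smul_apply, smul_eq_mul, mul_comm (Real.log _)]

/-- A step rescales only the cells of `S j`, by a common factor, so the gain involves only the
`j`-th subset sums. -/
theorem logFit_ipfStep {r : ι → ℝ} (hq : 0 < γ * (modelMatrix S).mulVec q j)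
    (ha : 0 < (modelMatrix S).mulVec δ j) (hδ : ∀ i, 0 < δ i)
    (hr : (modelMatrix S).mulVec r j = γ * (modelMatrix S).mulVec q j) :
    logFit r (ipfStep S q γ j δ) = logFit r δ +
      ((γ * (modelMatrix S).mulVec q j * Real.log (γ * (modelMatrix S).mulVec q j) -
        γ * (modelMatrix S).mulVec q j) -
      (γ * (modelMatrix S).mulVec q j * Real.log ((modelMatrix S).mulVec δ j) -
        (modelMatrix S).mulVec δ j)) := by
  simp only [logFit, log_ipfStep hq ha hδ]
  simp only [ipfStep_eq]
  rw [Real.log_div hq.ne' ha.ne']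
  set b := γ * (modelMatrix S).mulVec q j
  set a := (modelMatrix S).mulVec δ j with ha'
  have h1 : ∑ i, modelMatrix S j i * δ i = a := rfl
  have h2 : ∑ i, modelMatrix S j i * r i = b := hr
  have h3 : ∀ i, r i * (Real.log (δ i) + modelMatrix S j i * (Real.log b - Real.log a)) -
      (δ i + modelMatrix S j i * δ i * (b / a - 1)) = (r i * Real.log (δ i) - δ i) +
      ((modelMatrix S j i * r i) * (Real.log b - Real.log a) -
        modelMatrix S j i * δ i * (b / a - 1)) := fun i => by ring
  simp only [h3]
  rw [Finset.sum_add_distrib, Finset.sum_sub_distrib (fun i => _ * (Real.log b - Real.log a)),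
    ← Finset.sum_mul, ← Finset.sum_mul, h1, h2]
  field_simp
  ring

end Step

/-! ### Convergence of IPF. -/

section Convergence

variable [NeZero J] {S : Fin J → Finset ι} {q r : ι → ℝ} {γ : ℝ}

theorem ipf_add_one (d : ℕ) :
    ipf S q γ (d + 1) = ipfStep S q γ (Fin.ofNat J d) (ipf S q γ d) :=
  rfl

theorem ipf_pos (hS : ∀ j, (S j).Nonempty)
    (hq : ∀ j, 0 < γ * (modelMatrix S).mulVec q j) (d : ℕ) (i : ι) : 0 < ipf S q γ d i := by
  induction d generalizing i with
  | zero => exact one_pos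
  | succ d ih => exact ipfStep_pos (hq _) (modelMatrix_mulVec_pos hS ih _) ih i

theorem log_ipf_mem (hS : ∀ j, (S j).Nonempty)
    (hq : ∀ j, 0 < γ * (modelMatrix S).mulVec q j) (d : ℕ) :
    (fun i => Real.log (ipf S q γ d i)) ∈ logSpace S := by
  induction d with
  | zero =>
    convert (logSpace S).zero_mem using 1
    funext i
    simp [ipf]
  | succ d ih =>
    have hp := ipf_pos hS hq d
    exact log_ipfStep_mem (hq _) (modelMatrix_mulVec_pos hS hp _) hp ih

theorem monotone_logFit_ipf (hS : ∀ j, (S j).Nonempty)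
    (hq : ∀ j, 0 < γ * (modelMatrix S).mulVec q j)
    (hr : (modelMatrix S).mulVec r = γ • (modelMatrix S).mulVec q) :
    Monotone fun d => logFit r (ipf S q γ d) := by
  refine monotone_nat_of_le_succ fun d => ?_
  have hp := ipf_pos hS hq d
  have ha := modelMatrix_mulVec_pos hS hp (Fin.ofNat J d)
  have h := mul_log_sub_le (hq (Fin.ofNat J d)) ha
  have h2 := logFit_ipfStep (hq _) ha hp (congrFun hr _)
  rw [ipf, h2]
  linarith

theorem exists_tendsto_logFit_ipf (hS : ∀ j, (S j).Nonempty) (hrpos : ∀ i, 0 < r i)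
    (hq : ∀ j, 0 < γ * (modelMatrix S).mulVec q j)
    (hr : (modelMatrix S).mulVec r = γ • (modelMatrix S).mulVec q) :
    ∃ L, Tendsto (fun d => logFit r (ipf S q γ d)) atTop (𝓝 L) :=
  ⟨_, tendsto_atTop_ciSup (monotone_logFit_ipf hS hq hr)
    ⟨logFit r r, by rintro _ ⟨d, rfl⟩; exact logFit_le hrpos (ipf_pos hS hq d)⟩⟩

theorem exists_compact_ipf_mem (hS : ∀ j, (S j).Nonempty) (hrpos : ∀ i, 0 < r i)
    (hq : ∀ j, 0 < γ * (modelMatrix S).mulVec q j)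
    (hr : (modelMatrix S).mulVec r = γ • (modelMatrix S).mulVec q) :
    ∃ K : Set (ι → ℝ), IsCompact K ∧ (∀ δ ∈ K, ∀ i, 0 < δ i) ∧ ∀ d, ipf S q γ d ∈ K := by
  obtain ⟨K, hK, hpos, hmem⟩ := exists_compact_of_le_logFit hrpos (logFit r (ipf S q γ 0))
  exact ⟨K, hK, hpos, fun d => hmem _ (ipf_pos hS hq d)
    (monotone_logFit_ipf hS hq hr (Nat.zero_le d))⟩

/-- Limits of the IPF sequence along complete cycles are fixed by the remaining steps. -/
theorem tendsto_ipf_add_of_tendsto (hS : ∀ j, (S j).Nonempty) (hrpos : ∀ i, 0 < r i)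
    (hq : ∀ j, 0 < γ * (modelMatrix S).mulVec q j)
    (hr : (modelMatrix S).mulVec r = γ • (modelMatrix S).mulVec q) {φ : ℕ → ℕ}
    (hφ : StrictMono φ) {δ : ι → ℝ} (hδ : ∀ i, 0 < δ i)
    (h : Tendsto (fun n => ipf S q γ (J * φ n)) atTop (𝓝 δ)) (k : ℕ) :
    Tendsto (fun n => ipf S q γ (J * φ n + k)) atTop (𝓝 δ) ∧
      (modelMatrix S).mulVec δ (Fin.ofNat J k) =
        γ * (modelMatrix S).mulVec q (Fin.ofNat J k) := by
  have step : ∀ k, Tendsto (fun n => ipf S q γ (J * φ n + k)) atTop (𝓝 δ) →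
      (modelMatrix S).mulVec δ (Fin.ofNat J k) =
        γ * (modelMatrix S).mulVec q (Fin.ofNat J k) := by
    intro k hk
    set j := Fin.ofNat J k with hj
    have hjn : ∀ n, Fin.ofNat J (J * φ n + k) = j := fun n => by
      simp [hj, Fin.ext_iff]
    obtain ⟨L, hL⟩ := exists_tendsto_logFit_ipf hS hrpos hq hr
    have hmul : Tendsto (fun n => J * φ n) atTop atTop :=
      hφ.tendsto_atTop.const_mul_atTop' (NeZero.pos J)
    have hinc : ∀ m, Tendsto (fun n => J * φ n + m) atTop atTop := fun m =>
      tendsto_atTop_mono (fun n => Nat.le_add_right _ m) hmul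
    -- Consecutive values of a convergent sequence differ by a null sequence, while the gain
    -- converges to the divergence at `δ`; the latter is thus zero.
    have hdiff := (hL.comp (hinc (k + 1))).sub (hL.comp (hinc k))
    rw [sub_self] at hdiff
    have ha := modelMatrix_mulVec_pos hS hδ j
    have hcont : Tendsto (fun n => (modelMatrix S).mulVec (ipf S q γ (J * φ n + k)) j) atTop
        (𝓝 ((modelMatrix S).mulVec δ j)) :=
      ((continuous_modelMatrix_mulVec S j).tendsto δ).comp hk
    set b := γ * (modelMatrix S).mulVec q j with hb
    have hlim := (((hcont.log ha.ne').const_mul b).sub hcont).const_sub (b * Real.log b - b)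
    have heq := tendsto_nhds_unique hdiff (hlim.congr fun n => by
      have hp := ipf_pos hS hq (J * φ n + k)
      have h2 := logFit_ipfStep (hq j) (modelMatrix_mulVec_pos hS hp j) hp (congrFun hr _)
      simp only [Function.comp_apply, ← add_assoc, ipf_add_one, hjn n]
      rw [h2]
      ring)
    by_contra hne
    have := mul_log_sub_lt (hq j) ha hne
    linarith
  suffices hk : Tendsto (fun n => ipf S q γ (J * φ n + k)) atTop (𝓝 δ) from ⟨hk, step k hk⟩
  induction k with
  | zero => exact h
  | succ k ih =>
    have ha := modelMatrix_mulVec_pos hS hδ (Fin.ofNat J k)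
    have h1 := (continuousAt_ipfStep (q := q) (γ := γ) ha).tendsto.comp ih
    rw [ipfStep_eq_self ha (step k ih)] at h1
    refine h1.congr fun n => ?_
    have hjn : Fin.ofNat J (J * φ n + k) = Fin.ofNat J k := by simp [Fin.ext_iff]
    simp only [Function.comp_apply, ← add_assoc, ipf_add_one, hjn]

/-- The monotone sequence `logFit δ (ipf d)` converges, and its limit is read off the subsequence as
the maximum `logFit δ δ`. Every cluster point attains it and so equals `δ`. -/
theorem tendsto_ipf_of_subseq (hS : ∀ j, (S j).Nonempty)
    (hq : ∀ j, 0 < γ * (modelMatrix S).mulVec q j) {δ : ι → ℝ} (hδ : ∀ i, 0 < δ i)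
    (hA : (modelMatrix S).mulVec δ = γ • (modelMatrix S).mulVec q) {φ : ℕ → ℕ}
    (hφ : Tendsto φ atTop atTop)
    (h : Tendsto (fun n => ipf S q γ (φ n)) atTop (𝓝 δ)) :
    Tendsto (ipf S q γ) atTop (𝓝 δ) := by
  obtain ⟨K, hK, hpos, hmem⟩ := exists_compact_ipf_mem hS hδ hq hA
  obtain ⟨L, hL⟩ := exists_tendsto_logFit_ipf hS hδ hq hA
  have hLδ : L = logFit δ δ := tendsto_nhds_unique (hL.comp hφ)
    ((continuousAt_logFit δ hδ).tendsto.comp h)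
  refine hK.tendsto_nhds_of_unique_mapClusterPt (Eventually.of_forall hmem) fun z hz hcl => ?_
  refine eq_of_logFit_eq hδ (hpos z hz) ?_
  have hcl' : MapClusterPt (logFit δ z) atTop (fun d => logFit δ (ipf S q γ d)) :=
    hcl.continuousAt_comp (continuousAt_logFit δ (hpos z hz))
  rw [← hLδ]
  exact eq_of_nhds_neBot (ClusterPt.mono hcl' hL)

/-- If the linear family is non-empty, `IPF(γ)` converges to a point of it in the model. -/
theorem exists_tendsto_ipf (hS : ∀ j, (S j).Nonempty) (hrpos : ∀ i, 0 < r i)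
    (hr : (modelMatrix S).mulVec r = γ • (modelMatrix S).mulVec q) :
    ∃ δ, δ ∈ model (positiveIntensities ι) S ∧
      (modelMatrix S).mulVec δ = γ • (modelMatrix S).mulVec q ∧
      Tendsto (ipf S q γ) atTop (𝓝 δ) := by
  have hq : ∀ j, 0 < γ * (modelMatrix S).mulVec q j := fun j =>
    (modelMatrix_mulVec_pos hS hrpos j).trans_eq (congrFun hr j)
  obtain ⟨K, hK, hpos, hmem⟩ := exists_compact_ipf_mem hS hrpos hq hr
  -- Multiples of `J` keep the subset adjusted at offset `k` independent of `n`.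
  obtain ⟨δ, hδK, φ, hφ, hlim⟩ := hK.tendsto_subseq fun n => hmem (J * n)
  have hδ := hpos δ hδK
  have hA : (modelMatrix S).mulVec δ = γ • (modelMatrix S).mulVec q := by
    funext j
    have := (tendsto_ipf_add_of_tendsto hS hrpos hq hr hφ hδ hlim j).2
    simpa using this
  have htend := tendsto_ipf_of_subseq hS hq hδ hA
    (hφ.tendsto_atTop.const_mul_atTop' (NeZero.pos J)) hlim
  exact ⟨δ, mem_model_iff.2 ⟨hδ, log_mem_of_tendsto hδ htend (log_ipf_mem hS hq)⟩, hA, htend⟩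

theorem tendsto_ipf (hS : ∀ j, (S j).Nonempty) {δ : ι → ℝ}
    (hδ : δ ∈ model (positiveIntensities ι) S)
    (hA : (modelMatrix S).mulVec δ = γ • (modelMatrix S).mulVec q) :
    Tendsto (ipf S q γ) atTop (𝓝 δ) := by
  obtain ⟨δ', hδ', hA', h⟩ := exists_tendsto_ipf hS hδ.1 hA
  rwa [eq_of_mem_model_of_mulVec_eq hδ hδ' (hA.trans hA'.symm)]

end Convergence

/-! ### Likelihood equations and adjustment factors. -/

section Likelihood

variable {S : Fin J → Finset ι}

theorem model_probabilities_subset :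
    model (positiveProbabilities ι) S ⊆ model (positiveIntensities ι) S :=
  fun _ h => ⟨h.1.1, h.2⟩

/-- The likelihood equations for intensities. -/
theorem isPoissonMLE_iff {y : ι → ℕ} {l : ι → ℝ} :
    IsPoissonMLE S y l ↔ l ∈ model (positiveIntensities ι) S ∧
      (modelMatrix S).mulVec l = (modelMatrix S).mulVec (counts y) := by
  refine and_congr_right fun hl => ⟨fun h => ?_, fun h l' hl' => ?_⟩
  · funext j
    have hmax : IsLocalMax (fun t : ℝ => ∑ i, (counts y i * (Real.log (l i) +
        t * modelMatrix S j i) - l i * Real.exp (t * modelMatrix S j i))) 0 := by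
      refine Eventually.of_forall fun t => ?_
      have hmem := add_smul_row_mem_model hl j t
      have := (poissonProb_le_iff hl.1 hmem.1 y).1 (h _ hmem)
      simp only [logFit] at this
      simp only [zero_mul, add_zero, Real.exp_zero, mul_one]
      refine (le_of_eq (Finset.sum_congr rfl fun i _ => ?_)).trans this
      rw [Real.log_mul (hl.1 i).ne' (Real.exp_pos _).ne', Real.log_exp]
    have hder : HasDerivAt (fun t : ℝ => ∑ i, (counts y i * (Real.log (l i) +
        t * modelMatrix S j i) - l i * Real.exp (t * modelMatrix S j i)))
        (∑ i, (counts y i * modelMatrix S j i - l i * modelMatrix S j i)) 0 := by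
      refine HasDerivAt.fun_sum fun i _ => ?_
      have h1 : HasDerivAt (fun t : ℝ => t * modelMatrix S j i) (modelMatrix S j i) 0 := by
        simpa using (hasDerivAt_id (0 : ℝ)).mul_const (modelMatrix S j i)
      have h2 := ((h1.const_add (Real.log (l i))).const_mul (counts y i)).sub
        (h1.exp.const_mul (l i))
      simpa only [zero_mul, Real.exp_zero, one_mul] using! h2
    have h0 := hmax.hasDerivAt_eq_zero hder
    rw [Finset.sum_sub_distrib, sub_eq_zero] at h0
    simp only [Matrix.mulVec, dotProduct, mul_comm (modelMatrix S j _)]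
    exact h0.symm
  · refine (poissonProb_le_iff hl.1 hl'.1 y).2 ?_
    rw [mem_model_iff] at hl hl'
    rw [← logFit_congr h hl.2, ← logFit_congr h hl'.2]
    exact logFit_le hl.1 hl'.1

/-- Every cell lies in some generating subset as soon as the model for probabilities has a
point. -/
theorem exists_mem_of_mem_model (hS : ∀ j, (S j).Nonempty) [NeZero J] {p : ι → ℝ}
    (hp : p ∈ model (positiveProbabilities ι) S) (i : ι) : ∃ j, i ∈ S j := by
  by_contra! hi
  obtain ⟨k, hk⟩ := hS 0
  -- An uncovered cell has log-probability 0, leaving no mass for the cell `k` of `S 0`.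
  have hpi : p i = 1 := by
    obtain ⟨β, hβ⟩ := eq_exp_of_mem_model positiveProbabilities_subset hp
    rw [hβ]
    simp [Matrix.mulVec, dotProduct, modelMatrix, hi]
  have hki : i ≠ k := fun h => hi 0 (h ▸ hk)
  have h1 := Finset.add_le_sum (fun i _ => (hp.1.1 i).le) (Finset.mem_univ i)
    (Finset.mem_univ k) hki
  have := hp.1.1 k
  rw [hp.1.2] at h1
  linarith

/-- A linear functional is stationary on the model for probabilities only where it is
proportional, on the row space, to the point itself. -/
theorem exists_mulVec_eq_smul_of_isMaxOn [NeZero J] (hS : ∀ j, (S j).Nonempty) {q p : ι → ℝ}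
    (hp : p ∈ model (positiveProbabilities ι) S)
    (hmax : ∀ p' ∈ model (positiveProbabilities ι) S,
      ∑ i, q i * Real.log (p' i) ≤ ∑ i, q i * Real.log (p i)) :
    ∃ c : ℝ, (modelMatrix S).mulVec q = c • (modelMatrix S).mulVec p := by
  obtain ⟨β, hβ⟩ := eq_exp_of_mem_model positiveProbabilities_subset hp
  let B : ι → (Fin J → ℝ) →L[ℝ] ℝ := fun i =>
    (ContinuousLinearMap.proj i).comp
      (LinearMap.toContinuousLinearMap (modelMatrix S).transpose.mulVecLin)
  have hB : ∀ i b, B i b = (modelMatrix S).transpose.mulVec b i := fun i b => rfl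
  have hf : HasStrictFDerivAt (fun b => ∑ i, Real.exp (B i b))
      (∑ i, Real.exp (B i β) • B i) β :=
    HasStrictFDerivAt.fun_sum fun i _ => (B i).hasStrictFDerivAt.exp
  have hφ : HasStrictFDerivAt (fun b => ∑ i, q i * B i b) (∑ i, q i • B i) β :=
    HasStrictFDerivAt.fun_sum fun i _ => (B i).hasStrictFDerivAt.const_mul (q i)
  have hsum : ∑ i, Real.exp (B i β) = 1 := by
    rw [← hp.1.2, hβ]
    rfl
  -- In the coordinates `β` the model is a level set of the total, so Lagrange multipliers apply.
  have hextr : IsLocalExtrOn (fun b => ∑ i, q i * B i b)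
      {b | (∑ i, Real.exp (B i b)) = ∑ i, Real.exp (B i β)} β := by
    refine Or.inr (IsMaxOn.localize fun b hb => ?_)
    have hb' : ∑ i, Real.exp (B i b) = 1 := (show _ = _ from hb).trans hsum
    have := hmax (fun i => Real.exp (B i b))
      ⟨⟨fun i => Real.exp_pos _, hb'⟩, b, by simp only [Real.log_exp]; rfl⟩
    rw [hβ] at this
    simp only [Real.log_exp] at this
    exact this
  obtain ⟨a, b, hab, h⟩ := hextr.exists_multipliers_of_hasStrictFDerivAt_1d hf hφ
  have hBj : ∀ i j, B i (Pi.single j 1) = modelMatrix S j i := fun i j => by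
    rw [hB, Matrix.mulVec_single_one]
    rfl
  have key : ∀ j, a * (modelMatrix S).mulVec p j + b * (modelMatrix S).mulVec q j = 0 := by
    intro j
    have hj := DFunLike.congr_fun h (Pi.single j 1)
    simp only [add_apply, smul_apply,
      sum_apply, hBj, smul_eq_mul, zero_apply] at hj
    rw [← hj, hβ]
    simp only [Matrix.mulVec, dotProduct, mul_comm (modelMatrix S j _)]
    rfl
  -- If `b` vanished, positivity of the subset sums of `p` would make `a` vanish too.
  have hb : b ≠ 0 := by
    rintro rfl
    have h0 := key 0
    rw [zero_mul, add_zero] at h0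
    have ha := (mul_eq_zero.1 h0).resolve_right (modelMatrix_mulVec_pos hS hp.1.1 0).ne'
    exact hab (by rw [ha]; rfl)
  refine ⟨-a / b, funext fun j => ?_⟩
  rw [Pi.smul_apply, smul_eq_mul]
  field_simp
  linarith [key j]

/-- The likelihood equations for probabilities. -/
theorem isMultinomialMLE_iff [NeZero J] (hS : ∀ j, (S j).Nonempty) {N : ℕ} {y : ι → ℕ}
    (hN : 0 < N) (hy : ∑ i, y i = N) {p : ι → ℝ} :
    IsMultinomialMLE S N y p ↔ p ∈ model (positiveProbabilities ι) S ∧ ∃ γ : ℝ, 0 < γ ∧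
      (modelMatrix S).mulVec p = γ • (modelMatrix S).mulVec (relFreq y) := by
  have hN' : (0 : ℝ) < N := by positivity
  refine and_congr_right fun hp => ⟨fun h => ?_, ?_⟩
  · obtain ⟨c, hc⟩ := exists_mulVec_eq_smul_of_isMaxOn (q := relFreq y) hS hp fun p' hp' => by
      have := (multinomialProb_le_iff hy hp.1.1 hp'.1.1).1 (h p' hp')
      rwa [sum_counts_eq hN hy, sum_counts_eq hN hy, mul_le_mul_iff_right₀ hN'] at this
    -- An observed cell lies in some subset, whose positive observed sum fixes the sign of `c`.
    obtain ⟨i, hi⟩ : ∃ i, y i ≠ 0 := by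
      by_contra! h0
      simp [h0] at hy
      omega
    obtain ⟨j, hj⟩ := exists_mem_of_mem_model hS hp i
    have hpos : 0 < (modelMatrix S).mulVec (relFreq y) j := by
      rw [modelMatrix_mulVec_apply]
      refine Finset.sum_pos' (fun k _ => by unfold relFreq; positivity) ⟨i, hj, ?_⟩
      rw [relFreq, ← Nat.cast_sum, hy]
      positivity
    have hcpos : 0 < c := by
      rw [hc] at hpos
      exact pos_of_mul_pos_left hpos (modelMatrix_mulVec_pos hS hp.1.1 j).le
    exact ⟨c⁻¹, inv_pos.2 hcpos, by rw [hc, inv_smul_smul₀ hcpos.ne']⟩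
  · rintro ⟨γ, hγ, hA⟩ p' hp'
    refine (multinomialProb_le_iff hy hp.1.1 hp'.1.1).2 ?_
    -- Scaling by `γ` turns `q` into `p` on the row space; as all totals are 1, the claim becomes
    -- `logFit p p' ≤ logFit p p`.
    rw [sum_counts_eq hN hy, sum_counts_eq hN hy, mul_le_mul_iff_right₀ hN',
      ← mul_le_mul_iff_right₀ hγ]
    rw [mem_model_iff] at hp hp'
    rw [← sum_mul_eq_of_mem_logSpace hA hp.2, ← sum_mul_eq_of_mem_logSpace hA hp'.2]
    have h := logFit_le hp.1.1 hp'.1.1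
    simp only [logFit, Finset.sum_sub_distrib, hp.1.2, hp'.1.2] at h
    linarith

/-- For total 1, `logFit p` and `logFit p'` are, on the model, positive multiples of the same
functional `∑ q log` up to constants. Each of `p`, `p'` maximizes it, hence `p' = p`, and a positive
subset sum gives the factor. -/
theorem adjustment_unique [NeZero J] (hS : ∀ j, (S j).Nonempty) {q : ι → ℝ} {γ γ' : ℝ}
    (h : IsAdjustmentFactor S q γ) (h' : IsAdjustmentFactor S q γ') : γ' = γ := by
  obtain ⟨hγ, p, hp, -, hA⟩ := h
  obtain ⟨hγ', p', hp', -, hA'⟩ := h'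
  have hm := (mem_model_iff.1 hp).2
  have hm' := (mem_model_iff.1 hp').2
  have h1 := sum_mul_eq_of_mem_logSpace hA hm
  have h2 := sum_mul_eq_of_mem_logSpace hA hm'
  have h3 := sum_mul_eq_of_mem_logSpace hA' hm
  have h4 := sum_mul_eq_of_mem_logSpace hA' hm'
  have h5 := logFit_le hp.1.1 hp'.1.1
  have h6 := logFit_le hp'.1.1 hp.1.1
  have heq : logFit p p' = logFit p p → p' = p := eq_of_logFit_eq hp.1.1 hp'.1.1
  simp only [logFit, Finset.sum_sub_distrib, hp.1.2, hp'.1.2, h1, h2, h3, h4] at h5 h6 heq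
  have h7 := le_of_mul_le_mul_left (sub_le_sub_iff_right _ |>.1 h5) hγ
  have h8 := le_of_mul_le_mul_left (sub_le_sub_iff_right _ |>.1 h6) hγ'
  obtain rfl := heq (by rw [le_antisymm h7 h8])
  have hpos := modelMatrix_mulVec_pos hS hp.1.1 0
  have h9 : γ * _ = γ' * _ := (congrFun hA 0).symm.trans (congrFun hA' 0)
  have h10 := (congrFun hA 0)
  rw [h10] at hpos
  exact (mul_right_cancel₀ (right_ne_zero_of_mul hpos.ne') h9).symm

/-- The total of a vector is determined by its subset sums if the overall effect is present. -/
theorem HasOverallEffect.sum_eq (h : HasOverallEffect S) {r q : ι → ℝ} {γ : ℝ}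
    (hA : (modelMatrix S).mulVec r = γ • (modelMatrix S).mulVec q) :
    ∑ i, r i = γ * ∑ i, q i := by
  simpa using sum_mul_eq_of_mem_logSpace hA ((hasOverallEffect_iff S).1 h)

end Likelihood

end RelationalModel

open RelationalModel
theorem mainTheorem5 {ι : Type*} [Fintype ι] [DecidableEq ι] {J : ℕ} [NeZero J]
    (S : Fin J → Finset ι) (hS : ∀ j, (S j).Nonempty) :
    -- multinomial sampling
    (∀ (N : ℕ) (y : ι → ℕ), 0 < N → ∑ i, y i = N →
      -- with the overall effect
      (HasOverallEffect S →
        ((∃ p, IsMultinomialMLE S N y p) ↔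
          (linearFamily (positiveProbabilities ι) S (relFreq y) 1).Nonempty) ∧
        ∀ p, IsMultinomialMLE S N y p →
          Tendsto (ipf S (relFreq y) 1) atTop (𝓝 p)) ∧
      -- without the overall effect
      (¬ HasOverallEffect S →
        ((∃ p, IsMultinomialMLE S N y p) ↔ ∃ γ, IsAdjustmentFactor S (relFreq y) γ) ∧
        ∀ γ, IsAdjustmentFactor S (relFreq y) γ →
          (∀ γ', IsAdjustmentFactor S (relFreq y) γ' → γ' = γ) ∧
          ∀ p, IsMultinomialMLE S N y p →
            Tendsto (ipf S (relFreq y) γ) atTop (𝓝 p))) ∧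
    -- Poisson sampling, with or without the overall effect
    (∀ y : ι → ℕ,
      ((∃ l, IsPoissonMLE S y l) ↔
        (linearFamily (positiveIntensities ι) S (counts y) 1).Nonempty) ∧
      ∀ l, IsPoissonMLE S y l →
        Tendsto (ipf S (counts y) 1) atTop (𝓝 l)) := by
  refine ⟨fun N y hN hy => ?_, fun y => ?_⟩
  · have hmle := fun p => isMultinomialMLE_iff hS hN hy (p := p)
    refine ⟨fun hO => ?_, fun _ => ?_⟩
    · have hone : ∀ p, IsMultinomialMLE S N y p → p ∈ model (positiveProbabilities ι) S ∧
          (modelMatrix S).mulVec p = (1 : ℝ) • (modelMatrix S).mulVec (relFreq y) := by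
        intro p h
        obtain ⟨hp, γ, -, hA⟩ := (hmle p).1 h
        have hγ := hO.sum_eq hA
        rw [hp.1.2, sum_relFreq hN hy, mul_one] at hγ
        exact ⟨hp, hγ ▸ hA⟩
      refine ⟨⟨fun ⟨p, h⟩ => ⟨p, (hone p h).1.1, (hone p h).2⟩, fun ⟨r, hr, hA⟩ => ?_⟩,
        fun p h => tendsto_ipf hS (model_probabilities_subset (hone p h).1) (hone p h).2⟩
      -- Existence comes from the IPF limit, whose total is 1 by the overall effect.
      obtain ⟨p, hp, hAp, -⟩ := exists_tendsto_ipf hS hr.1 hA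
      have hsum := hO.sum_eq hAp
      rw [sum_relFreq hN hy, mul_one] at hsum
      exact ⟨p, (hmle p).2 ⟨⟨⟨hp.1, hsum⟩, hp.2⟩, 1, one_pos, hAp⟩⟩
    · have hadj : ∀ p, IsMultinomialMLE S N y p → ∃ γ, IsAdjustmentFactor S (relFreq y) γ ∧
          p ∈ model (positiveProbabilities ι) S ∧
          (modelMatrix S).mulVec p = γ • (modelMatrix S).mulVec (relFreq y) := by
        intro p h
        obtain ⟨hp, γ, hγ, hA⟩ := (hmle p).1 h
        exact ⟨γ, ⟨hγ, p, hp, hp.1, hA⟩, hp, hA⟩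
      refine ⟨⟨fun ⟨p, h⟩ => (hadj p h).imp fun _ => And.left,
        fun ⟨γ, hγ, p, hp, hA⟩ => ⟨p, (hmle p).2 ⟨hp, γ, hγ, hA.2⟩⟩⟩,
        fun γ hγ => ⟨fun γ' hγ' => adjustment_unique hS hγ hγ', fun p h => ?_⟩⟩
      obtain ⟨γ', hγ', hp, hA⟩ := hadj p h
      rw [adjustment_unique hS hγ hγ'] at hA
      exact tendsto_ipf hS (model_probabilities_subset hp) hA
  · have hmle := fun l => isPoissonMLE_iff (S := S) (y := y) (l := l)
    refine ⟨⟨fun ⟨l, h⟩ => ?_, fun ⟨r, hr, hA⟩ => ?_⟩, fun l h => ?_⟩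
    · obtain ⟨hl, hA⟩ := (hmle l).1 h
      exact ⟨l, hl.1, by rw [hA, one_smul]⟩
    · obtain ⟨l, hl, hAl, -⟩ := exists_tendsto_ipf hS hr hA
      exact ⟨l, (hmle l).2 ⟨hl, by rw [hAl, one_smul]⟩⟩
    · obtain ⟨hl, hA⟩ := (hmle l).1 h
      exact tendsto_ipf hS hl (by rw [hA, one_smul])
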